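/- Setting. Let $s\ge 1$, $n,r\ge 0$ be integers. Fix a reference Lagrange finite element $(\hat T,\hat V,\hat N)$ of polynomial order $r$: $\hat T\subset\mathbb R^s$ is a closed convex polytope with nonempty interior, $\hat V$ is a space of polynomials on $\hat T$ containing all polynomials of degree at most $r$, and $\hat N\subset\hat T$ is a finite set of nodes such that every $c:\hat N\to\mathbb R$ is interpolated by exactly one element of $\hat V$. An affine-equivalent mesh $\mathcal G$ of an open bounded set $\Omega\subset\mathbb R^s$ is a finite collection of closed elements $T=F_T(\hat T)$, with $F_T$ an invertible affine map, that cover $\overline\Omega$, have disjoint interiors and pairwise intersect in common (possibly empty) faces, together with the Lagrange points $\{\xi_i\}_{i\in I}=\bigcup_T F_T(\hat N)$ and a nodal basis of continuous functions $\phi_i:\overline\Omega\to\mathbb R$ with $\phi_i\circ F_T\in\hat V$ for all $T$ and $\phi_i(\xi_j)=\delta_{ij}$. Put $h_T=\operatorname{diam}T$ and $h=\max_{T\in\mathcal G}h_T$. For $\kappa,\tau>0$ the mesh is shape regular with parameter $\kappa$ if every $T$ contains a ball of radius $\kappa h_T$, and quasi-uniform with parameter $\tau$ if $h_T\ge\tau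 h$ for every $T$. Let $M\subset\mathbb R^n$ be an embedded submanifold (or any subset), and let $\delta>0$ be such that every point of $U_\delta=\{z:\operatorname{dist}(z,M)<\delta\}$ has exactly one closest point $P(z)$ in $M$, and such that the closest-point projection $P$ is weakly differentiable on $U_\delta$ with $|P|_{W^{1,\infty}(U_\delta)}\le L<\infty$. For continuous $v:\overline\Omega\to M$ put $Q_{\mathbb R^n}v=\sum_{i\in I}v(\xi_i)\phi_i$ and, if $Q_{\mathbb R^n}v(\overline\Omega)\subset U_\delta$, let $Q_Mv=P\circ Q_{\mathbb R^n}v$ be the projected finite element function. Here $|u|_{W^{1,p}(T)}$ is the $L^p$ norm over the interior of $T$ of the operator norm of the weak derivative of $u$. Theorem 2.5. Let $p,q\in[1,\infty]$ with $p>s$. Then for all $\kappa,\tau,D>0$ and $L\ge0$ there is a constant $C>0$, depending only on $s$, $n$, $r$, $p$, $q$, the reference element, $\kappa$, $\tau$, $D$ and $L$ (in particular not on $h$), such that for every $\Omega$ with $\operatorname{diam}\Omega\le D$, every affine-equivalent mesh $\mathcal G$ of $\Omega$ with this reference element that is shape regular with parameter $\kappa$ and quasi-uniform with parameter $\tau$,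 all $M$ and $\delta$ as above, and every continuous $v:\overline\Omega\to M$ with $Q_{\mathbb R^n}v(\overline\Omega)\subset U_\delta$, on each element $T\in\mathcal G$ we have $|Q_Mv|_{W^{1,p}(T)}<\infty$ and $$|Q_Mv|_{W^{1,q}(T)}\le C\,h^{-s\max\{0,\frac1p-\frac1q\}}\,|Q_Mv|_{W^{1,p}(T)}.$$ -/

import Mathlib

open MeasureTheory Set
open scoped ENNReal NNReal ContDiff

noncomputable section

/-- The Euclidean space `ℝ^d`. -/
abbrev Euc (d : ℕ) : Type := EuclideanSpace ℝ (Fin d)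

/-- `g` is the weak (distributional) derivative of `u` on the open set `U`. The integrands vanish
outside `U`, because the test function does. -/
structure HasWeakFDeriv {d m : ℕ} (U : Set (Euc d)) (u : Euc d → Euc m)
    (g : Euc d → Euc d →L[ℝ] Euc m) : Prop where
  locallyIntegrable_fun : LocallyIntegrableOn u U
  locallyIntegrable_deriv : LocallyIntegrableOn g U
  integral_by_parts : ∀ η : Euc d → ℝ, ContDiff ℝ ∞ η → HasCompactSupport η → tsupport η ⊆ U →
    ∀ e : Euc d, ∫ x, fderiv ℝ η x e • u x = - ∫ x, η x • g x e

/-- The seminorm `|u|_{W^{1,p}(U)}`, the `L^p(U)` norm of the weak derivative of `u`, with values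
in `[0,∞]`. Weak derivatives are unique up to null sets, so the infimum is the norm of any of them;
it is `∞` if there is none. -/
def sobolevSeminorm {d m : ℕ} (p : ℝ≥0∞) (U : Set (Euc d)) (u : Euc d → Euc m) : ℝ≥0∞ :=
  ⨅ (g : Euc d → Euc d →L[ℝ] Euc m) (_ : HasWeakFDeriv U u g), eLpNorm g p (volume.restrict U)

/-- A Lagrange finite element (in the sense of Ciarlet) in `ℝ^s` of polynomial order `r`: a convex
polytope with nonempty interior, given by a finite set of points spanning it, a space of polynomial
shape functions that contains all polynomials of degree at most `r`, and Lagrange nodes in the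
polytope which are unisolvent for the shape functions. -/
structure LagrangeElement (s r : ℕ) where
  vertices : Finset (Euc s)
  interior_nonempty : (interior (convexHull ℝ (vertices : Set (Euc s)))).Nonempty
  shape : Submodule ℝ (MvPolynomial (Fin s) ℝ)
  degree_le_shape : MvPolynomial.restrictTotalDegree (Fin s) ℝ r ≤ shape
  numNodes : ℕ
  node : Fin numNodes → Euc s
  node_mem : ∀ j, node j ∈ convexHull ℝ (vertices : Set (Euc s))
  unisolvent : ∀ c : Fin numNodes → ℝ,
    ∃! f : MvPolynomial (Fin s) ℝ,
      f ∈ shape ∧ ∀ j, MvPolynomial.eval (fun i => node j i) f = c j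

/-- The closed polytope on which a Lagrange element lives. -/
def LagrangeElement.carrier {s r : ℕ} (R : LagrangeElement s r) : Set (Euc s) :=
  convexHull ℝ (R.vertices : Set (Euc s))

/-- A finite mesh of `Ω ⊆ ℝ^s` whose elements are affine images of one reference Lagrange element
`R` and intersect in common faces, together with the nodal basis `basis i` and the Lagrange points
`point i` of the (continuous) scalar Lagrange finite element space on it. -/
structure LagrangeMesh {s r : ℕ} (R : LagrangeElement s r) (Ω : Set (Euc s)) where
  numElements : ℕ
  chart : Fin numElements → (Euc s ≃ᵃ[ℝ] Euc s)
  iUnion_eq : ⋃ k, chart k '' R.carrier = closure Ω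
  interior_disjoint : ∀ k l, k ≠ l →
    Disjoint (interior (chart k '' R.carrier)) (interior (chart l '' R.carrier))
  common_face : ∀ k l,
    IsExposed ℝ (chart k '' R.carrier) (chart k '' R.carrier ∩ chart l '' R.carrier)
  numPoints : ℕ
  point : Fin numPoints → Euc s
  range_point : range point = ⋃ k, chart k '' range R.node
  basis : Fin numPoints → Euc s → ℝ
  basis_continuous : ∀ i, ContinuousOn (basis i) (closure Ω)
  basis_shape : ∀ i k, ∃ f ∈ R.shape, ∀ x ∈ R.carrier,
    basis i (chart k x) = MvPolynomial.eval (fun a => x a) f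
  basis_point : ∀ i j, basis i (point j) = if i = j then 1 else 0

namespace LagrangeMesh

variable {s r : ℕ} {R : LagrangeElement s r} {Ω : Set (Euc s)}

/-- The `k`-th (closed) element of the mesh. -/
def element (G : LagrangeMesh R Ω) (k : Fin G.numElements) : Set (Euc s) :=
  G.chart k '' R.carrier

/-- The mesh width `h`, the maximal element diameter. -/
def width (G : LagrangeMesh R Ω) : ℝ := ⨆ k, Metric.diam (G.element k)

/-- Shape regularity with parameter `κ`: every element `T` contains a ball of radius
`κ * diam T`. -/
def ShapeRegular (G : LagrangeMesh R Ω) (κ : ℝ) : Prop :=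
  ∀ k, ∃ x, Metric.ball x (κ * Metric.diam (G.element k)) ⊆ G.element k

/-- Quasi-uniformity with parameter `τ`: every element has diameter at least `τ * h`. -/
def QuasiUniform (G : LagrangeMesh R Ω) (τ : ℝ) : Prop :=
  ∀ k, τ * G.width ≤ Metric.diam (G.element k)

/-- The Lagrange interpolation operator `Q_{ℝⁿ}`: `v ↦ ∑ i, v(ξ_i) φ_i`. -/
def interpolate {n : ℕ} (G : LagrangeMesh R Ω) (v : Euc s → Euc n) : Euc s → Euc n :=
  fun x => ∑ i, G.basis i x • v (G.point i)

end LagrangeMesh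

/-- `y` minimizes the Euclidean distance to `z` among the points of `M`. -/
def IsClosestPoint {n : ℕ} (M : Set (Euc n)) (z y : Euc n) : Prop :=
  y ∈ M ∧ ∀ y' ∈ M, ‖y - z‖ ≤ ‖y' - z‖

/-- The closest-point projection `P` onto `M`; of interest only at points that have exactly one
closest point in `M`. -/
def closestPoint {n : ℕ} (M : Set (Euc n)) (z : Euc n) : Euc n :=
  Classical.epsilon (IsClosestPoint M z)

/-- The projected interpolation operator `Q_M = P ∘ Q_{ℝⁿ}`. -/
def LagrangeMesh.projInterpolate {s r n : ℕ} {R : LagrangeElement s r} {Ω : Set (Euc s)}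
    (G : LagrangeMesh R Ω) (M : Set (Euc n)) (v : Euc s → Euc n) : Euc s → Euc n :=
  fun x => closestPoint M (G.interpolate v x)

end

/-!
The inverse estimate holds because the interpolant is a polynomial, hence controlled by its nodal
values, and because the projected interpolant has the same nodal values.

Fix an element `T` of diameter `h_T`, write `u` for the interpolant of `v`, `w = P ∘ u` for the
projected one, `|T|` for the volume of `T` and `N` for the `L^p` norm of the derivative of `w` over
`T`. Since the reference nodal basis sums to `1`, the increments of `u` on `T` involve only the
differences of nodal values, and `u` is Lipschitz on `T` with constant at most a multiple of
`h_T⁻¹ * max |v(ξ_i) - v(ξ_j)|`, where shape regularity bounds the inverse chart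
(`LagrangeMesh.exists_norm_interpolate_sub_le`). The projection fixes `M`, so
`v(ξ_i) - v(ξ_j) = w(ξ_i) - w(ξ_j)`, and since `p > s`, Morrey's inequality on the convex set `T`
(`norm_sub_le_eLpNorm_fderiv`) bounds this by a multiple of `h_T |T|^{-1/p} N`. The projection is
continuous with weak derivative bounded by `L`, hence Lipschitz with constant `L + 1` on the balls
contained in the tubular neighbourhood (`norm_closestPoint_sub_le`). Together the derivative of `w`
is at most a multiple of `|T|^{-1/p} N` pointwise, and its `L^q` norm at most a multiple of
`|T|^{1/q - 1/p} N`. Finally `|T|` is comparable to `h ^ s` from below by shape regularity and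
quasi-uniformity, and bounded above in terms of `D` (`LagrangeMesh.exists_volume_rpow_le`).

All Sobolev seminorms are computed from pointwise derivatives: `w` is Lipschitz on `T`, so by
Rademacher's theorem its pointwise derivative is its weak derivative, which is unique up to null
sets (`LipschitzOnWith.hasWeakFDeriv`, `sobolevSeminorm_eq_eLpNorm`).
-/

/-! ### Weak derivatives of Lipschitz functions -/

theorem MeasureTheory.LocallyIntegrableOn.integrable_smul_of_tsupport_subset {E F : Type*}
    [NormedAddCommGroup E] [MeasurableSpace E] [BorelSpace E]
    [NormedAddCommGroup F] [NormedSpace ℝ F] {μ : Measure E} {U : Set E} {f : E → F} {η : E → ℝ}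
    (hf : LocallyIntegrableOn f U μ) (hη : Continuous η) (hc : HasCompactSupport η)
    (hs : tsupport η ⊆ U) : Integrable (fun x => η x • f x) μ := by
  have h : IntegrableOn (fun x => η x • f x) (tsupport η) μ :=
    (hf.integrableOn_compact_subset hs hc).continuousOn_smul hη.continuousOn hc
  refine (integrableOn_iff_integrable_of_support_subset fun x hx => subset_tsupport η ?_).1 h
  rw [Function.mem_support] at hx ⊢
  exact fun h0 => hx (by simp [h0])

theorem HasWeakFDeriv.ae_eq {d m : ℕ} {U : Set (Euc d)} (hU : IsOpen U) {u : Euc d → Euc m}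
    {g g' : Euc d → Euc d →L[ℝ] Euc m} (hg : HasWeakFDeriv U u g) (hg' : HasWeakFDeriv U u g') :
    g =ᵐ[volume.restrict U] g' := by
  have key := hU.ae_eq_zero_of_integral_contDiff_smul_eq_zero
    (hg.locallyIntegrable_deriv.sub hg'.locallyIntegrable_deriv) (μ := volume) (by
      intro η hη hc hs
      have hint : ∀ {f : Euc d → Euc d →L[ℝ] Euc m}, LocallyIntegrableOn f U →
          Integrable (fun x => η x • f x) := fun hf =>
        LocallyIntegrableOn.integrable_smul_of_tsupport_subset hf hη.continuous hc hs
      have h1 := hint hg.locallyIntegrable_deriv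
      have h2 := hint hg'.locallyIntegrable_deriv
      have : ∀ x, η x • (g - g') x = η x • g x - η x • g' x := fun x => by
        simp [smul_sub]
      simp_rw [this]
      rw [integral_sub h1 h2, sub_eq_zero]
      ext1 e
      rw [ContinuousLinearMap.integral_apply h1, ContinuousLinearMap.integral_apply h2]
      have e1 := hg.integral_by_parts η hη hc hs e
      have e2 := hg'.integral_by_parts η hη hc hs e
      simpa using neg_injective (e1.symm.trans e2))
  rw [Filter.EventuallyEq, ae_restrict_iff' hU.measurableSet]
  filter_upwards [key] with x hx hxU
  exact sub_eq_zero.1 (hx hxU)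

/-- Integration by parts against a compactly supported Lipschitz function, for vector-valued
Lipschitz functions: Rademacher's theorem makes the derivative exist almost everywhere. -/
theorem LipschitzWith.integral_fderiv_smul_eq {d m : ℕ} {K C : ℝ≥0} {w : Euc d → Euc m}
    (hw : LipschitzWith K w) {η : Euc d → ℝ} (hη : Differentiable ℝ η) (hη' : LipschitzWith C η)
    (hc : HasCompactSupport η) (e : Euc d) :
    ∫ x, fderiv ℝ η x e • w x = - ∫ x, η x • fderiv ℝ w x e := by
  have hdiff := hw.ae_differentiableAt (μ := volume)
  have hwd : LocallyIntegrable (fderiv ℝ w) := by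
    refine MemLp.locallyIntegrable (p := ⊤) ?_ le_top
    exact memLp_top_of_bound (measurable_fderiv ℝ w).aestronglyMeasurable K
      (.of_forall fun x => norm_fderiv_le_of_lipschitz ℝ hw)
  have hi2 : Integrable (fun x => η x • fderiv ℝ w x) :=
    hwd.integrable_smul_left_of_hasCompactSupport hη.continuous hc
  have hi2' : Integrable (fun x => η x • fderiv ℝ w x e) := by
    simpa using hi2.apply_continuousLinearMap e
  have hηd : MemLp (fun x => fderiv ℝ η x e) ⊤ := by
    refine memLp_top_of_bound (measurable_fderiv_apply_const ℝ η e).aestronglyMeasurable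
      (C * ‖e‖) (.of_forall fun x => ?_)
    exact (fderiv ℝ η x).le_of_opNorm_le (norm_fderiv_le_of_lipschitz ℝ hη') e
  have hi1 : Integrable (fun x => fderiv ℝ η x e • w x) := by
    have hcd : HasCompactSupport fun x => fderiv ℝ η x e := hc.fderiv_apply ℝ e
    have h : IntegrableOn (fun x => fderiv ℝ η x e • w x) (tsupport fun x => fderiv ℝ η x e) := by
      refine Integrable.smul_of_top_right ?_ (hηd.restrict _)
      exact hw.continuous.continuousOn.integrableOn_compact hcd
    refine (integrableOn_iff_integrable_of_support_subset fun x hx => subset_tsupport _ ?_).1 h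
    rw [Function.mem_support] at hx ⊢
    exact fun h0 => hx (by simp [h0])
  ext a
  let π : Euc m →L[ℝ] ℝ := EuclideanSpace.proj a
  have hL : LipschitzWith (‖π‖₊ * K) (fun x => π (w x)) := π.lipschitz.comp hw
  have key := hL.integral_lineDeriv_mul_eq (μ := volume) hη' hc e
  have c1 : (∫ x, fderiv ℝ η x e • w x) a = ∫ x, fderiv ℝ η x e * w x a :=
    (π.integral_comp_comm hi1).symm
  have c2 : (∫ x, η x • fderiv ℝ w x e) a = ∫ x, η x * fderiv ℝ w x e a :=
    (π.integral_comp_comm hi2').symm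
  rw [PiLp.neg_apply, c1, c2]
  have l1 : ∫ x, lineDeriv ℝ (fun x => π (w x)) x e * η x = ∫ x, η x * fderiv ℝ w x e a := by
    refine integral_congr_ae ?_
    filter_upwards [hdiff] with x hx
    have := (π.hasFDerivAt.comp x hx.hasFDerivAt).hasLineDerivAt e
    rw [show (fun x => π (w x)) = π ∘ w from rfl, this.lineDeriv, mul_comm]
    rfl
  have l2 : ∫ x, lineDeriv ℝ η x (-e) * π (w x) = - ∫ x, fderiv ℝ η x e * w x a := by
    rw [← integral_neg]
    congr 1 with x
    rw [(hη x).lineDeriv_eq_fderiv, map_neg, neg_mul]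
    rfl
  rw [l1, l2] at key
  rw [key, neg_neg]

/-- The pointwise derivative of a Lipschitz function is its weak derivative. -/
theorem LipschitzOnWith.hasWeakFDeriv {d m : ℕ} {U : Set (Euc d)} (hU : IsOpen U) {K : ℝ≥0}
    {w : Euc d → Euc m} (hw : LipschitzOnWith K w U) : HasWeakFDeriv U w (fderiv ℝ w) := by
  have hb : ∀ x ∈ U, ‖fderiv ℝ w x‖ ≤ K := fun x hx =>
    norm_fderiv_le_of_lipschitzOn ℝ (hU.mem_nhds hx) hw
  refine ⟨hw.continuousOn.locallyIntegrableOn hU.measurableSet, ?_, ?_⟩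
  · refine locallyIntegrableOn_of_locallyIntegrable_restrict
      (MemLp.locallyIntegrable (p := ⊤) ?_ le_top)
    refine memLp_top_of_bound (measurable_fderiv ℝ w).aestronglyMeasurable K ?_
    exact (ae_restrict_iff' hU.measurableSet).2 (.of_forall hb)
  intro η hη hc hs e
  obtain ⟨w', hw', hww'⟩ := hw.extend_finite_dimension
  obtain ⟨C, hC⟩ := hη.lipschitzWith_of_hasCompactSupport hc (by simp)
  have key := hw'.integral_fderiv_smul_eq (hη.differentiable (by simp)) hC hc e
  have h1 : ∀ x, fderiv ℝ η x e • w x = fderiv ℝ η x e • w' x := fun x => by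
    by_cases hx : x ∈ U
    · rw [hww' hx]
    · have : x ∉ tsupport (fderiv ℝ η) := fun h => hx (hs (tsupport_fderiv_subset ℝ h))
      simp [image_eq_zero_of_notMem_tsupport this]
  have h2 : ∀ x, η x • fderiv ℝ w x e = η x • fderiv ℝ w' x e := fun x => by
    by_cases hx : x ∈ U
    · rw [(hww'.symm.eventuallyEq_of_mem (hU.mem_nhds hx)).fderiv_eq]
    · have : x ∉ tsupport η := fun h => hx (hs h)
      simp [image_eq_zero_of_notMem_tsupport this]
  simp_rw [h1, h2]
  exact key

theorem sobolevSeminorm_eq_eLpNorm {d m : ℕ} {U : Set (Euc d)} (hU : IsOpen U) {u : Euc d → Euc m}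
    {g : Euc d → Euc d →L[ℝ] Euc m} (hg : HasWeakFDeriv U u g) (p : ℝ≥0∞) :
    sobolevSeminorm p U u = eLpNorm g p (volume.restrict U) := by
  refine le_antisymm (iInf₂_le g hg) (le_iInf₂ fun g' hg' => ?_)
  exact (eLpNorm_congr_ae (hg.ae_eq hU hg')).le

/-! ### Lipschitz bounds from bounded weak derivatives -/

open Filter Topology in
/-- Mollify: `x ↦ ∫ φ (x - ξ) • u ξ` has derivative `e ↦ ∫ φ (x - ξ) • g ξ e`, which inherits the
bound on `g`, and the bound survives the limit in the mean value inequality. -/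
theorem HasWeakFDeriv.norm_sub_le {d m : ℕ} {U : Set (Euc d)} (hU : IsOpen U)
    {u : Euc d → Euc m} (hu : ContinuousOn u U) {g : Euc d → Euc d →L[ℝ] Euc m}
    (hg : HasWeakFDeriv U u g) {K : ℝ} (hK : ∀ᵐ x ∂volume.restrict U, ‖g x‖ ≤ K)
    {z : Euc d} {ρ : ℝ} (hρ : Metric.ball z ρ ⊆ U) {x y : Euc d}
    (hx : x ∈ Metric.ball z ρ) (hy : y ∈ Metric.ball z ρ) : ‖u y - u x‖ ≤ K * ‖y - x‖ := by
  have hρ0 : 0 < ρ := Metric.pos_of_mem_ball hx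
  obtain ⟨σ, hσx, hσρ⟩ := exists_between (max_lt (Metric.mem_ball.1 hx) (Metric.mem_ball.1 hy))
  obtain ⟨hσx, hσy⟩ := max_lt_iff.1 hσx
  have hσ0 : 0 < σ := dist_nonneg.trans_lt hσx
  obtain ⟨σ', hσσ', hσ'ρ⟩ := exists_between hσρ
  have hB : Metric.closedBall z σ' ⊆ U := (Metric.closedBall_subset_ball hσ'ρ).trans hρ
  -- Cutting `u` off outside a compact ball makes it globally integrable.
  let u' : Euc d → Euc m := (Metric.closedBall z σ').indicator u
  have hu'i : Integrable u' :=
    ((hu.mono hB).integrableOn_compact (isCompact_closedBall z σ')).integrable_indicator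
      Metric.isClosed_closedBall.measurableSet
  have hu'l : LocallyIntegrable u' := hu'i.locallyIntegrable
  let φ : ℕ → ContDiffBump (0 : Euc d) := fun N =>
    ⟨(σ' - σ) / 2 / (N + 1) / 2, (σ' - σ) / 2 / (N + 1), by
      have : 0 < σ' - σ := sub_pos.2 hσσ'
      positivity, half_lt_self (by
      have : 0 < σ' - σ := sub_pos.2 hσσ'
      positivity)⟩
  have hφr : ∀ N, (φ N).rOut < σ' - σ := fun N => by
    have h0 : 0 < σ' - σ := sub_pos.2 hσσ'
    calc (φ N).rOut = (σ' - σ) / 2 / (N + 1) := rfl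
      _ ≤ (σ' - σ) / 2 := div_le_self (by positivity) (by simp)
      _ < σ' - σ := half_lt_self h0
  have hφ0 : Tendsto (fun N => (φ N).rOut) atTop (𝓝 0) :=
    ((tendsto_const_div_atTop_nhds_zero_nat ((σ' - σ) / 2)).comp (tendsto_add_atTop_nat 1)).congr
      fun N => by simp [φ]
  let F : ℕ → Euc d → Euc m := fun N =>
    convolution ((φ N).normed volume) u' (ContinuousLinearMap.lsmul ℝ ℝ) volume
  have hlim : ∀ y ∈ Metric.ball z σ, Tendsto (fun N => F N y) atTop (𝓝 (u y)) := by
    intro y hy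
    refine ContDiffBump.convolution_tendsto_right (g := fun _ => u') (k := fun _ => y) (x₀ := y) hφ0
      (.of_forall fun _ => hu'i.aestronglyMeasurable) ?_ tendsto_const_nhds
    have hnb : Metric.ball z σ ∈ 𝓝 y := Metric.isOpen_ball.mem_nhds hy
    have hcont : ContinuousAt u y := hu.continuousAt (mem_of_superset hnb
      ((Metric.ball_subset_closedBall.trans (Metric.closedBall_subset_closedBall hσσ'.le)).trans hB))
    have : Tendsto u' (𝓝 y) (𝓝 (u y)) := by
      refine hcont.tendsto.congr' ?_
      filter_upwards [hnb] with x hx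
      exact (indicator_of_mem (Metric.closedBall_subset_closedBall hσσ'.le
        (Metric.ball_subset_closedBall hx)) u).symm
    exact this.comp tendsto_snd
  have hder : ∀ N, ∀ x ∈ Metric.ball z σ, ∃ f' : Euc d →L[ℝ] Euc m,
      HasFDerivAt (F N) f' x ∧ ‖f'‖ ≤ K := by
    intro N x hx
    have hφs : ContDiff ℝ ∞ ((φ N).normed volume) := (φ N).contDiff_normed
    have hφc : HasCompactSupport ((φ N).normed volume) := (φ N).hasCompactSupport_normed
    have hD := hφc.hasFDerivAt_convolution_left (ContinuousLinearMap.lsmul ℝ ℝ)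
      (hφs.of_le (by simp)) hu'l x
    refine ⟨_, hD, ?_⟩
    have hconvint : ConvolutionExistsAt (fderiv ℝ ((φ N).normed volume)) u' x
        (ContinuousLinearMap.precompL (Euc d) (ContinuousLinearMap.lsmul ℝ ℝ)) volume :=
      (hφc.fderiv ℝ).convolutionExists_left _ (hφs.continuous_fderiv (by simp)) hu'l x
    -- The test function is the kernel `ξ ↦ φ (x - ξ)`.
    let η : Euc d → ℝ := fun ξ => (φ N).normed volume (x - ξ)
    have hηs : ContDiff ℝ ∞ η := hφs.comp (contDiff_const.sub contDiff_id)
    have hηsupp : tsupport η ⊆ Metric.closedBall x (φ N).rOut := by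
      refine closure_minimal (fun ξ hξ => ?_) Metric.isClosed_closedBall
      have : x - ξ ∈ Function.support ((φ N).normed volume) := hξ
      rw [(φ N).support_normed_eq, mem_ball_zero_iff] at this
      rw [Metric.mem_closedBall, dist_comm, dist_eq_norm]
      exact this.le
    have hsub : Metric.closedBall x (φ N).rOut ⊆ Metric.closedBall z σ' := by
      refine Metric.closedBall_subset_closedBall' ?_
      have := Metric.mem_ball.1 hx
      have := hφr N
      linarith
    have hηc : HasCompactSupport η :=
      (isCompact_closedBall x _).of_isClosed_subset (isClosed_tsupport η) hηsupp
    have hηU : tsupport η ⊆ U := hηsupp.trans (hsub.trans hB)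
    have hη0 : ∀ ξ, 0 ≤ η ξ := fun ξ => (φ N).nonneg_normed _
    have hη1 : ∫ ξ, η ξ = 1 := by
      rw [integral_sub_left_eq_self ((φ N).normed volume) volume x, (φ N).integral_normed]
    have hK0 : 0 ≤ K := by
      have : (volume.restrict U) ≠ 0 := by
        rw [Ne, Measure.restrict_eq_zero]
        exact (hU.measure_pos volume ⟨x, hB (hsub (Metric.mem_closedBall_self (φ N).rOut_pos.le))⟩).ne'
      have : (ae (volume.restrict U)).NeBot := ae_neBot.2 this
      obtain ⟨x, hx⟩ := hK.exists
      exact (norm_nonneg _).trans hx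
    refine ContinuousLinearMap.opNorm_le_bound _ hK0 fun e => ?_
    have e1 : (convolution (fderiv ℝ ((φ N).normed volume)) u'
        (ContinuousLinearMap.precompL (Euc d) (ContinuousLinearMap.lsmul ℝ ℝ)) volume x) e =
        - ∫ ξ, fderiv ℝ η ξ e • u ξ := by
      rw [convolution_eq_swap, ContinuousLinearMap.integral_apply hconvint.integrable_swap,
        ← integral_neg]
      congr 1 with ξ : 1
      have hd : fderiv ℝ η ξ e = - fderiv ℝ ((φ N).normed volume) (x - ξ) e := by
        have h1 : HasFDerivAt (fun ξ : Euc d => x - ξ) (-ContinuousLinearMap.id ℝ (Euc d)) ξ :=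
          (hasFDerivAt_id ξ).const_sub x
        have h2 := ((hφs.differentiable (by simp)) (x - ξ)).hasFDerivAt.comp ξ h1
        have h3 : fderiv ℝ η ξ = _ := h2.fderiv
        rw [h3]
        simp
      rw [ContinuousLinearMap.precompL_apply, ContinuousLinearMap.lsmul_apply]
      by_cases hξ : ξ ∈ Metric.closedBall z σ'
      · rw [hd, neg_smul, neg_neg, show u' ξ = u ξ from indicator_of_mem hξ u]
      · have : ξ ∉ tsupport (fderiv ℝ η) :=
          fun h => hξ (hsub (hηsupp (tsupport_fderiv_subset ℝ h)))
        have h0 := image_eq_zero_of_notMem_tsupport this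
        rw [h0] at hd
        rw [h0, show u' ξ = 0 from indicator_of_notMem hξ u]
        simp
    rw [e1, hg.integral_by_parts η hηs hηc hηU e, neg_neg]
    have hηi : Integrable η := hηs.continuous.integrable_of_hasCompactSupport hηc
    calc ‖∫ ξ, η ξ • g ξ e‖ ≤ ∫ ξ, η ξ * (K * ‖e‖) := by
          refine norm_integral_le_of_norm_le (hηi.mul_const _) ?_
          filter_upwards [(ae_restrict_iff' hU.measurableSet).1 hK] with ξ hξ
          rw [norm_smul, Real.norm_of_nonneg (hη0 ξ)]
          by_cases hξU : ξ ∈ U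
          · exact mul_le_mul_of_nonneg_left ((g ξ).le_of_opNorm_le (hξ hξU) e) (hη0 ξ)
          · rw [image_eq_zero_of_notMem_tsupport fun h => hξU (hηU h)]
            simp
      _ = K * ‖e‖ := by rw [integral_mul_const, hη1, one_mul]
  choose! f' hf' hf'K using hder
  have hbound : ∀ N, ‖F N y - F N x‖ ≤ K * ‖y - x‖ := fun N =>
    (convex_ball z σ).norm_image_sub_le_of_norm_hasFDerivWithin_le
      (fun x hx => (hf' N x hx).hasFDerivWithinAt) (hf'K N) hσx hσy
  exact le_of_tendsto ((hlim y hσy).sub (hlim x hσx)).norm (.of_forall hbound)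

/-! ### The closest-point projection -/

theorem closestPoint_spec {n : ℕ} {M : Set (Euc n)} {z : Euc n} (h : ∃! y, IsClosestPoint M z y) :
    IsClosestPoint M z (closestPoint M z) :=
  Classical.epsilon_spec h.exists

theorem closestPoint_of_mem {n : ℕ} {M : Set (Euc n)} {z : Euc n} (hz : z ∈ M) :
    closestPoint M z = z := by
  have h : IsClosestPoint M z z := ⟨hz, fun y _ => by simp⟩
  have h' : IsClosestPoint M z (closestPoint M z) := Classical.epsilon_spec ⟨z, h⟩
  simpa [sub_eq_zero] using h'.2 z hz

theorem IsClosestPoint.norm_sub_eq_infDist {n : ℕ} {M : Set (Euc n)} {z y : Euc n}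
    (h : IsClosestPoint M z y) : ‖y - z‖ = Metric.infDist z M := by
  refine le_antisymm ((Metric.le_infDist ⟨y, h.1⟩).2 fun y' hy' => ?_) ?_
  · rw [dist_comm, dist_eq_norm]
    exact h.2 y' hy'
  · rw [← dist_eq_norm, dist_comm]
    exact Metric.infDist_le_dist_of_mem h.1

open Filter Topology in
/-- Closest points of points near `z` stay in a bounded set and can accumulate only at the unique
closest point of `z`. -/
theorem continuousOn_closestPoint {n : ℕ} {M : Set (Euc n)} {δ : ℝ} (hδ : 0 < δ)
    (h : ∀ z ∈ Metric.thickening δ M, ∃! y, IsClosestPoint M z y) :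
    ContinuousOn (closestPoint M) (Metric.thickening δ M) := by
  have hclosed : IsClosed M := by
    refine isClosed_of_closure_subset fun z hz => ?_
    have hzU : z ∈ Metric.thickening δ M := Metric.closure_subset_thickening hδ M hz
    have hs := closestPoint_spec (h z hzU)
    have := hs.norm_sub_eq_infDist
    rw [Metric.mem_closure_iff_infDist_zero ⟨_, hs.1⟩] at hz
    rw [hz, norm_eq_zero, sub_eq_zero] at this
    exact this ▸ hs.1
  intro z hz
  refine ContinuousAt.continuousWithinAt ?_
  have hU : Metric.thickening δ M ∈ 𝓝 z := Metric.isOpen_thickening.mem_nhds hz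
  have hev : ∀ᶠ x in 𝓝 z, IsClosestPoint M x (closestPoint M x) := by
    filter_upwards [hU] with x hx using closestPoint_spec (h x hx)
  let R : ℝ := Metric.infDist z M + 1
  have hnear : ∀ᶠ x in 𝓝 z, Metric.infDist x M + dist x z ≤ R := by
    have hc : Continuous fun x : Euc n => Metric.infDist x M + dist x z :=
      (Metric.continuous_infDist_pt M).add (continuous_id.dist continuous_const)
    refine (hc.tendsto z).eventually_le_const ?_
    simp [R]
  refine (isCompact_closedBall z R).tendsto_nhds_of_unique_mapClusterPt ?_ ?_
  · filter_upwards [hev, hnear] with x hx hxR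
    rw [Metric.mem_closedBall]
    calc dist (closestPoint M x) z ≤ dist (closestPoint M x) x + dist x z := dist_triangle _ _ _
      _ = Metric.infDist x M + dist x z := by rw [dist_eq_norm, hx.norm_sub_eq_infDist]
      _ ≤ R := hxR
  · intro y _ hy
    refine (h z hz).unique ?_ (closestPoint_spec (h z hz))
    obtain ⟨F, hF, hFy⟩ := mapClusterPt_iff_ultrafilter.1 hy
    refine ⟨hclosed.mem_of_tendsto hFy ((hev.filter_mono hF).mono fun x hx => hx.1), ?_⟩
    intro y' hy'
    have hFz : Tendsto (fun x : Euc n => x) F (𝓝 z) := hF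
    exact le_of_tendsto_of_tendsto (hFy.sub hFz).norm (tendsto_const_nhds.sub hFz).norm
      ((hev.filter_mono hF).mono fun x hx => hx.2 y' hy')

theorem norm_closestPoint_sub_le {n : ℕ} {M : Set (Euc n)} {δ : ℝ} (hδ : 0 < δ)
    (h : ∀ z ∈ Metric.thickening δ M, ∃! y, IsClosestPoint M z y) {L : ℝ≥0}
    (hL : sobolevSeminorm ⊤ (Metric.thickening δ M) (closestPoint M) ≤ L)
    {z : Euc n} {ρ : ℝ} (hρ : Metric.ball z ρ ⊆ Metric.thickening δ M) {x y : Euc n}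
    (hx : x ∈ Metric.ball z ρ) (hy : y ∈ Metric.ball z ρ) :
    ‖closestPoint M y - closestPoint M x‖ ≤ (L + 1) * ‖y - x‖ := by
  have hlt : sobolevSeminorm ⊤ (Metric.thickening δ M) (closestPoint M) < L + 1 :=
    hL.trans_lt (ENNReal.lt_add_right ENNReal.coe_ne_top one_ne_zero)
  obtain ⟨g, hg⟩ := iInf_lt_iff.1 hlt
  obtain ⟨hg, hgL⟩ := iInf_lt_iff.1 hg
  refine hg.norm_sub_le Metric.isOpen_thickening (continuousOn_closestPoint hδ h) (K := L + 1)
    ?_ hρ hx hy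
  rw [eLpNorm_exponent_top] at hgL
  filter_upwards [ae_le_eLpNormEssSup (f := g)] with x hx
  have : ‖g x‖ₑ ≤ ((L + 1 : ℝ≥0) : ℝ≥0∞) := by
    push_cast
    exact hx.trans hgL.le
  exact_mod_cast enorm_le_coe.1 this

/-- Composition with the closest-point projection is Lipschitz on compact sets, with the constant
of `u` multiplied by at most `L + 1` at small distances. -/
theorem closestPoint_comp_lipschitz {n : ℕ} {E : Type*} [NormedAddCommGroup E]
    {M : Set (Euc n)} {δ : ℝ} (hδ : 0 < δ)
    (h : ∀ z ∈ Metric.thickening δ M, ∃! y, IsClosestPoint M z y) {L : ℝ≥0}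
    (hL : sobolevSeminorm ⊤ (Metric.thickening δ M) (closestPoint M) ≤ L)
    {T : Set E} (hT : IsCompact T) {u : E → Euc n} {K : ℝ≥0} (hu : LipschitzOnWith K u T)
    (hmaps : MapsTo u T (Metric.thickening δ M)) :
    (∃ K', LipschitzOnWith K' (fun x => closestPoint M (u x)) T) ∧
    ∃ ε > 0, ∀ x ∈ T, ∀ y ∈ T, ‖y - x‖ < ε →
      ‖closestPoint M (u y) - closestPoint M (u x)‖ ≤ (L + 1) * K * ‖y - x‖ := by
  obtain ⟨ρ, hρ0, hρ⟩ := (hT.image_of_continuousOn hu.continuousOn).exists_cthickening_subset_open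
    Metric.isOpen_thickening (image_subset_iff.2 hmaps)
  have hball : ∀ x ∈ T, Metric.ball (u x) ρ ⊆ Metric.thickening δ M := fun x hx =>
    (Metric.ball_subset_thickening (mem_image_of_mem u hx) ρ).trans
      ((Metric.thickening_subset_cthickening ρ _).trans hρ)
  let ε : ℝ := ρ / (K + 1)
  have hε : 0 < ε := by positivity
  have hloc : ∀ x ∈ T, ∀ y ∈ T, ‖y - x‖ < ε →
      ‖closestPoint M (u y) - closestPoint M (u x)‖ ≤ (L + 1) * K * ‖y - x‖ := by
    intro x hx y hy hxy
    have h1 : ‖u y - u x‖ ≤ K * ‖y - x‖ := hu.norm_sub_le hy hx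
    have h2 : ‖u y - u x‖ < ρ := by
      rw [lt_div_iff₀ (by positivity)] at hxy
      nlinarith [norm_nonneg (y - x)]
    calc _ ≤ (L + 1) * ‖u y - u x‖ := norm_closestPoint_sub_le hδ h hL (hball x hx)
          (Metric.mem_ball_self hρ0) (by rwa [Metric.mem_ball, dist_eq_norm])
      _ ≤ (L + 1) * (K * ‖y - x‖) := by gcongr
      _ = _ := by ring
  refine ⟨?_, ε, hε, hloc⟩
  have hcomp : IsCompact ((fun x => closestPoint M (u x)) '' T) :=
    hT.image_of_continuousOn ((continuousOn_closestPoint hδ h).comp hu.continuousOn hmaps)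
  -- Points at distance at least `ε` are handled by the boundedness of the image.
  let B : ℝ := Metric.diam ((fun x => closestPoint M (u x)) '' T)
  have hB : 0 ≤ B := Metric.diam_nonneg
  refine ⟨((L + 1) * K + (B / ε).toNNReal : ℝ≥0), LipschitzOnWith.of_dist_le_mul fun y hy x hx => ?_⟩
  push_cast
  rw [Real.coe_toNNReal _ (by positivity), dist_eq_norm y x]
  rcases lt_or_ge ‖y - x‖ ε with hlt | hge
  · rw [dist_eq_norm]
    refine (hloc x hx y hy hlt).trans ?_
    gcongr
    exact le_add_of_nonneg_right (by positivity)
  · calc _ ≤ B := Metric.dist_le_diam_of_mem hcomp.isBounded (mem_image_of_mem _ hy)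
          (mem_image_of_mem _ hx)
      _ = B / ε * ε := by field_simp
      _ ≤ B / ε * ‖y - x‖ := by gcongr
      _ ≤ _ := by
        gcongr
        exact le_add_of_nonneg_left (by positivity)

/-! ### Morrey's inequality on convex sets -/

/-- Change of variables `y = a + t (x - a)` followed by Hölder's inequality on the contracted set,
whose measure is `t ^ d` times that of `U`. -/
theorem lintegral_contraction_le {d : ℕ} {F : Type*} [NormedAddCommGroup F]
    {U : Set (Euc d)} (hU : MeasurableSet U) {g : Euc d → F} (hg : AEStronglyMeasurable g)
    {a : Euc d} {t : ℝ} (ht : 0 < t) (hmaps : MapsTo (fun x => a + t • (x - a)) U U)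
    {p : ℝ≥0∞} (hp : 1 ≤ p) :
    ∫⁻ x in U, ‖g (a + t • (x - a))‖ₑ ≤ ENNReal.ofReal (t ^ d) ^ (-(p⁻¹).toReal) *
      volume U ^ (1 - (p⁻¹).toReal) * eLpNorm g p (volume.restrict U) := by
  let f : Euc d → Euc d := fun x => a + t • (x - a)
  let c : ℝ≥0∞ := ENNReal.ofReal (t ^ d)
  have hc0 : c ≠ 0 := (ENNReal.ofReal_pos.2 (by positivity)).ne'
  have hct : c ≠ ⊤ := ENNReal.ofReal_ne_top
  have hβ : (p⁻¹).toReal ≤ 1 := by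
    have := ENNReal.toReal_mono ENNReal.one_ne_top (ENNReal.inv_le_one.2 hp)
    simpa using this
  have hder : ∀ x ∈ U, HasFDerivWithinAt f (t • ContinuousLinearMap.id ℝ (Euc d)) U x := fun x _ =>
    ((((hasFDerivAt_id x).sub_const a).const_smul t).const_add a).hasFDerivWithinAt
  have hinj : InjOn f U := fun x _ y _ hxy => by
    have h : a + t • (x - a) = a + t • (y - a) := hxy
    simpa [ht.ne'] using h
  have hdet : ENNReal.ofReal |(t • ContinuousLinearMap.id ℝ (Euc d)).det| = c := by
    have : (t • ContinuousLinearMap.id ℝ (Euc d)).det = t ^ d := by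
      rw [ContinuousLinearMap.det, ContinuousLinearMap.toLinearMap_smul, LinearMap.det_smul]
      simp
    rw [this, abs_of_pos (by positivity)]
  have hint : ∫⁻ x in f '' U, ‖g x‖ₑ = c * ∫⁻ x in U, ‖g (f x)‖ₑ := by
    rw [lintegral_image_eq_lintegral_abs_det_fderiv_mul volume hU hder hinj]
    simp_rw [hdet]
    rw [lintegral_const_mul' _ _ hct]
  have hvol : volume (f '' U) = c * volume U := by
    have h := lintegral_image_eq_lintegral_abs_det_fderiv_mul volume hU hder hinj 1
    simpa [hdet] using h
  have hH : ∫⁻ x in f '' U, ‖g x‖ₑ ≤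
      eLpNorm g p (volume.restrict U) * (c * volume U) ^ (1 - (p⁻¹).toReal) := by
    rw [← eLpNorm_one_eq_lintegral_enorm, ← hvol]
    have h := eLpNorm_le_eLpNorm_mul_rpow_measure_univ (μ := volume.restrict (f '' U)) hp
      hg.restrict
    rw [Measure.restrict_apply_univ, ENNReal.toReal_one, div_one, one_div,
      ← ENNReal.toReal_inv] at h
    refine h.trans (mul_le_mul_left ?_ _)
    exact eLpNorm_mono_measure g (Measure.restrict_mono (image_subset_iff.2 hmaps) le_rfl)
  rw [hint] at hH
  have hexp : c ^ (-(p⁻¹).toReal) = c⁻¹ * c ^ (1 - (p⁻¹).toReal) := by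
    rw [← ENNReal.rpow_neg_one c, ← ENNReal.rpow_add _ _ hc0 hct]
    congr 1
    ring
  calc ∫⁻ x in U, ‖g (f x)‖ₑ = c⁻¹ * (c * ∫⁻ x in U, ‖g (f x)‖ₑ) := by
        rw [← mul_assoc, ENNReal.inv_mul_cancel hc0 hct, one_mul]
    _ ≤ c⁻¹ * (eLpNorm g p (volume.restrict U) * (c * volume U) ^ (1 - (p⁻¹).toReal)) := by
        gcongr
    _ = c⁻¹ * c ^ (1 - (p⁻¹).toReal) *
          volume U ^ (1 - (p⁻¹).toReal) * eLpNorm g p (volume.restrict U) := by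
        rw [ENNReal.mul_rpow_of_nonneg _ _ (by linarith)]
        ring
    _ = _ := by rw [← hexp]

open Filter Topology in
/-- The average of `w` over the contraction of `T` towards `a` by the factor `t` interpolates
between `w a` at `t = 0` and the average over `T` at `t = 1`; its derivative in `t` is
`O(t ^ (-d/p))`, which is integrable because `p > d`. -/
theorem norm_integral_sub_le_eLpNorm_fderiv {d m : ℕ} {T : Set (Euc d)} (hconv : Convex ℝ T)
    (hcomp : IsCompact T) {w : Euc d → Euc m} {K : ℝ≥0}
    (hw : LipschitzOnWith K w T) {p : ℝ≥0∞} (hp1 : 1 ≤ p) (hp : (d : ℝ≥0∞) < p) {a : Euc d}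
    (ha : a ∈ T) :
    ‖(∫ x in interior T, w x) - volume.real (interior T) • w a‖ ≤
      Metric.diam T * volume.real (interior T) ^ (1 - (p⁻¹).toReal) *
        (eLpNorm (fderiv ℝ w) p (volume.restrict (interior T))).toReal /
          (1 - d * (p⁻¹).toReal) := by
  set U := interior T with hUdef
  have hUo : IsOpen U := isOpen_interior
  have hUT : U ⊆ T := interior_subset
  set β : ℝ := (p⁻¹).toReal with hβ
  have hβ1 : d * β < 1 := by
    have h0 : p ≠ 0 := (zero_lt_one.trans_le hp1).ne'
    have h1 : (d : ℝ≥0∞) * p⁻¹ < 1 := by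
      rcases eq_or_ne p ⊤ with rfl | hpt
      · simp
      · rw [← div_eq_mul_inv]
        exact (ENNReal.div_lt_iff (.inl h0) (.inl hpt)).2 (by rwa [one_mul])
    have h2 := (ENNReal.toReal_lt_toReal h1.ne_top ENNReal.one_ne_top).2 h1
    simpa [hβ] using h2
  have hvolT : volume U ≠ ⊤ := ((measure_mono hUT).trans_lt hcomp.measure_lt_top).ne
  have : IsFiniteMeasure (volume.restrict U) := isFiniteMeasure_restrict.2 hvolT
  obtain ⟨w', hw', hww'⟩ := hw.extend_finite_dimension
  set K' := lipschitzExtensionConstant (Euc m) * K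
  have hfd : ∀ x ∈ U, fderiv ℝ w x = fderiv ℝ w' x := fun x hx =>
    ((hww'.mono hUT).eventuallyEq_of_mem (hUo.mem_nhds hx)).fderiv_eq
  have hN : eLpNorm (fderiv ℝ w) p (volume.restrict U) =
      eLpNorm (fderiv ℝ w') p (volume.restrict U) :=
    eLpNorm_congr_ae ((ae_restrict_iff' hUo.measurableSet).2 (.of_forall hfd))
  have hNtop : eLpNorm (fderiv ℝ w') p (volume.restrict U) ≠ ⊤ :=
    (MemLp.of_bound (measurable_fderiv ℝ w').aestronglyMeasurable K'
      (.of_forall fun x => norm_fderiv_le_of_lipschitz ℝ hw')).eLpNorm_ne_top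
  rw [hN]
  set N := (eLpNorm (fderiv ℝ w') p (volume.restrict U)).toReal with hNdef
  set V := volume.real U with hV
  let A : ℝ → Euc m := fun t => ∫ x in U, w' (a + t • (x - a))
  have hdiamx : ∀ x ∈ U, ‖x - a‖ ≤ Metric.diam T := fun x hx => by
    rw [← dist_eq_norm]
    exact Metric.dist_le_diam_of_mem hcomp.isBounded (hUT hx) ha
  have hAcont : Continuous A := by
    have : A = fun t => ∫ x in T, w' (a + t • (x - a)) := by
      ext1 t
      have : volume.restrict U = volume.restrict T :=
        Measure.restrict_congr_set (interior_ae_eq_of_null_frontier (hconv.addHaar_frontier volume))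
      simp only [A, this]
    rw [this]
    refine continuous_parametric_integral_of_continuous ?_ hcomp
    exact hw'.continuous.comp (by fun_prop)
  let A' : ℝ → Euc m := fun t => ∫ x in U, fderiv ℝ w' (a + t • (x - a)) (x - a)
  have hmeas : ∀ t : ℝ, Measurable fun x => fderiv ℝ w' (a + t • (x - a)) := fun t =>
    (measurable_fderiv ℝ w').comp (by fun_prop)
  have hAder : ∀ t : ℝ, 0 < t → HasDerivAt A (A' t) t := by
    intro t ht
    refine (hasDerivAt_integral_of_dominated_loc_of_lip (s := univ)
      (bound := fun _ => K' * Metric.diam T) univ_mem (.of_forall fun t' => ?_) ?_ ?_ ?_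
      (integrable_const _) ?_).2
    · exact (hw'.continuous.comp (by fun_prop)).aestronglyMeasurable
    · have hc : Continuous fun x => w' (a + t • (x - a)) := hw'.continuous.comp (by fun_prop)
      exact (hc.continuousOn.integrableOn_compact hcomp).mono_set hUT
    · exact isBoundedBilinearMap_apply.continuous.comp_aestronglyMeasurable
        ((hmeas t).aestronglyMeasurable.prodMk (by fun_prop))
    · refine (ae_restrict_iff' hUo.measurableSet).2 (.of_forall fun x hx => ?_)
      refine LipschitzOnWith.of_dist_le_mul fun t1 _ t2 _ => ?_
      have hpos : 0 ≤ K' * Metric.diam T := mul_nonneg K'.2 Metric.diam_nonneg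
      rw [Real.coe_nnabs, abs_of_nonneg hpos, dist_eq_norm, dist_eq_norm]
      refine (hw'.norm_sub_le _ _).trans ?_
      rw [add_sub_add_left_eq_sub, ← sub_smul, norm_smul]
      calc (K' : ℝ) * (‖t1 - t2‖ * ‖x - a‖) ≤ K' * (‖t1 - t2‖ * Metric.diam T) := by
            gcongr
            exact hdiamx x hx
        _ = _ := by ring
    · -- A homothety pulls the null set of non-differentiability back to a null set.
      have hnull : volume {x | ¬ DifferentiableAt ℝ w' (a + t • (x - a))} = 0 := by
        have h0 : volume {x | ¬ DifferentiableAt ℝ w' x} = 0 := hw'.ae_differentiableAt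
        refine measure_mono_null (t := AffineMap.homothety a t⁻¹ '' {x | ¬ DifferentiableAt ℝ w' x})
          (fun x hx => ⟨a + t • (x - a), hx, ?_⟩) ?_
        · simp [AffineMap.homothety_apply, smul_smul, ht.ne']
        · rw [Measure.addHaar_image_homothety, h0, mul_zero]
      have hae : ∀ᵐ x, DifferentiableAt ℝ w' (a + t • (x - a)) := hnull
      refine ae_restrict_of_ae ?_
      filter_upwards [hae] with x hx
      have hl : HasDerivAt (fun t : ℝ => a + t • (x - a)) (x - a) t := by
        simpa using ((hasDerivAt_id t).smul_const (x - a)).const_add a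
      exact hx.hasFDerivAt.comp_hasDerivAt t hl
  let Q : ℝ := Metric.diam T * V ^ (1 - β) * N
  have hA'bound : ∀ t ∈ Ioc (0 : ℝ) 1, ‖A' t‖ ≤ Q * t ^ (-(d * β)) := by
    intro t ht
    have hmaps : MapsTo (fun x => a + t • (x - a)) U U := fun x hx =>
      hconv.add_smul_sub_mem_interior ha hx ht
    have hH := lintegral_contraction_le hUo.measurableSet
      (measurable_fderiv ℝ w').aestronglyMeasurable ht.1 hmaps hp1
    have hint : Integrable (fun x => ‖fderiv ℝ w' (a + t • (x - a))‖) (volume.restrict U) :=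
      (Integrable.of_bound (hmeas t).aestronglyMeasurable K'
        (.of_forall fun x => norm_fderiv_le_of_lipschitz ℝ hw')).norm
    have h1 : ‖A' t‖ ≤ ∫ x in U, ‖fderiv ℝ w' (a + t • (x - a))‖ * Metric.diam T := by
      refine norm_integral_le_of_norm_le (hint.mul_const _) ?_
      refine (ae_restrict_iff' hUo.measurableSet).2 (.of_forall fun x hx => ?_)
      exact (ContinuousLinearMap.le_opNorm _ _).trans (by gcongr; exact hdiamx x hx)
    have hrhs : (ENNReal.ofReal (t ^ d) ^ (-β) * volume U ^ (1 - β) *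
        eLpNorm (fderiv ℝ w') p (volume.restrict U)).toReal = t ^ (-(d * β)) * V ^ (1 - β) * N := by
      rw [ENNReal.toReal_mul, ENNReal.toReal_mul, ← ENNReal.toReal_rpow, ← ENNReal.toReal_rpow,
        ENNReal.toReal_ofReal (by have := ht.1; positivity), ← Real.rpow_natCast,
        ← Real.rpow_mul ht.1.le, mul_neg]
      rfl
    have hU0 : ENNReal.ofReal (t ^ d) ^ (-β) * volume U ^ (1 - β) *
        eLpNorm (fderiv ℝ w') p (volume.restrict U) ≠ ⊤ := by
      refine ENNReal.mul_ne_top (ENNReal.mul_ne_top ?_ ?_) hNtop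
      · exact ENNReal.rpow_ne_top_of_ne_zero
          (ENNReal.ofReal_pos.2 (pow_pos ht.1 d)).ne' ENNReal.ofReal_ne_top
      · refine ENNReal.rpow_ne_top_of_nonneg ?_ hvolT
        have : β ≤ 1 := by
          have := ENNReal.toReal_mono ENNReal.one_ne_top (ENNReal.inv_le_one.2 hp1)
          simpa [hβ] using this
        linarith
    have h2 : ∫ x in U, ‖fderiv ℝ w' (a + t • (x - a))‖ ≤ t ^ (-(d * β)) * V ^ (1 - β) * N := by
      rw [integral_norm_eq_lintegral_enorm (hmeas t).aestronglyMeasurable, ← hrhs]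
      exact ENNReal.toReal_mono hU0 hH
    rw [integral_mul_const] at h1
    calc ‖A' t‖ ≤ _ := h1
      _ ≤ (t ^ (-(d * β)) * V ^ (1 - β) * N) * Metric.diam T := by
        gcongr
      _ = _ := by simp only [Q]; ring
  have hQ0 : 0 ≤ Q := by positivity
  have hexp : 0 < 1 - d * β := by linarith
  let B : ℝ → ℝ := fun t => Q / (1 - d * β) * t ^ (1 - d * β)
  have hBder : ∀ t : ℝ, 0 < t → HasDerivAt B (Q * t ^ (-(d * β))) t := by
    intro t ht
    have h := (Real.hasDerivAt_rpow_const (p := 1 - d * β) (.inl ht.ne')).const_mul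
      (Q / (1 - d * β))
    convert! h using 1
    rw [← mul_assoc, div_mul_cancel₀ _ hexp.ne']
    congr 2
    ring
  have hAε : ∀ ε ∈ Ioo (0 : ℝ) 1, ‖A 1 - A ε‖ ≤ Q / (1 - d * β) := by
    intro ε hε
    have h := image_norm_le_of_norm_deriv_right_le_deriv_boundary' (a := ε) (b := 1)
      (f := fun t => A t - A ε) (f' := A') (B := fun t => B t - B ε)
      (B' := fun t => Q * t ^ (-(d * β)))
      (hAcont.sub continuous_const).continuousOn
      (fun t ht => ((hAder t (hε.1.trans_le ht.1)).sub_const _).hasDerivWithinAt)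
      (by simp)
      (fun t ht => ((hBder t (hε.1.trans_le ht.1)).sub_const _).continuousAt.continuousWithinAt)
      (fun t ht => ((hBder t (hε.1.trans_le ht.1)).sub_const _).hasDerivWithinAt)
      (fun t ht => hA'bound t ⟨hε.1.trans_le ht.1, ht.2.le⟩)
      (right_mem_Icc.2 hε.2.le)
    refine h.trans ?_
    have : 0 ≤ B ε := by have := hε.1; positivity
    simp only [B, Real.one_rpow, mul_one] at this ⊢
    linarith
  have hlim : ‖A 1 - A 0‖ ≤ Q / (1 - d * β) := by
    have ht : Tendsto (fun ε => ‖A 1 - A ε‖) (𝓝[>] 0) (𝓝 ‖A 1 - A 0‖) :=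
      ((continuous_const.sub hAcont).norm.tendsto 0).mono_left nhdsWithin_le_nhds
    refine le_of_tendsto ht ?_
    filter_upwards [Ioo_mem_nhdsGT zero_lt_one] with ε hε using hAε ε hε
  have hA1 : A 1 = ∫ x in U, w x := by
    refine setIntegral_congr_fun hUo.measurableSet fun x hx => ?_
    simp [hww' (hUT hx)]
  have hA0 : A 0 = V • w a := by
    simp [A, hww' ha, V, Measure.real]
  rwa [hA1, hA0] at hlim

/-- **Morrey's inequality** on a compact convex set, with the dependence on the set made explicit. -/
theorem norm_sub_le_eLpNorm_fderiv {d m : ℕ} {T : Set (Euc d)} (hconv : Convex ℝ T)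
    (hcomp : IsCompact T) (hT : (interior T).Nonempty) {w : Euc d → Euc m} {K : ℝ≥0}
    (hw : LipschitzOnWith K w T) {p : ℝ≥0∞} (hp1 : 1 ≤ p) (hp : (d : ℝ≥0∞) < p) {a b : Euc d}
    (ha : a ∈ T) (hb : b ∈ T) :
    ‖w a - w b‖ ≤ 2 / (1 - d * (p⁻¹).toReal) * Metric.diam T *
      volume.real (interior T) ^ (-(p⁻¹).toReal) *
        (eLpNorm (fderiv ℝ w) p (volume.restrict (interior T))).toReal := by
  have hV : 0 < volume.real (interior T) := by
    refine ENNReal.toReal_pos (isOpen_interior.measure_pos volume hT).ne' ?_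
    exact ((measure_mono interior_subset).trans_lt hcomp.measure_lt_top).ne
  have h1 := norm_integral_sub_le_eLpNorm_fderiv hconv hcomp hw hp1 hp ha
  have h2 := norm_integral_sub_le_eLpNorm_fderiv hconv hcomp hw hp1 hp hb
  have h3 := (norm_sub_le_norm_sub_add_norm_sub (volume.real (interior T) • w a)
    (∫ x in interior T, w x) (volume.real (interior T) • w b))
  rw [← smul_sub, norm_smul, Real.norm_of_nonneg hV.le, norm_sub_rev _ (∫ x in interior T, w x)] at h3
  refine le_of_mul_le_mul_left ((h3.trans (add_le_add h1 h2)).trans_eq ?_) hV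
  rw [Real.rpow_sub hV, Real.rpow_one, Real.rpow_neg hV.le]
  ring

/-! ### Lagrange elements and meshes -/

theorem LipschitzOnWith.mvPolynomial_eval {s : ℕ} (f : MvPolynomial (Fin s) ℝ) {T : Set (Euc s)}
    (hconv : Convex ℝ T) (hcomp : IsCompact T) :
    ∃ K, LipschitzOnWith K (fun x : Euc s => MvPolynomial.eval (fun i => x i) f) T := by
  have h := AnalyticOnNhd.eval_continuousLinearMap' (𝕜 := ℝ)
    (fun i => (EuclideanSpace.proj i : Euc s →L[ℝ] ℝ)) f
  have h' : ContDiffOn ℝ 1 (fun x : Euc s => MvPolynomial.eval (fun i => x i) f) T :=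
    fun x _ => (h x (mem_univ x)).contDiffAt.contDiffWithinAt
  exact ContDiffOn.exists_lipschitzOnWith h' one_ne_zero hconv hcomp

namespace LagrangeElement

variable {s r : ℕ} (R : LagrangeElement s r)

theorem convex_carrier : Convex ℝ R.carrier := convex_convexHull ℝ _

theorem isCompact_carrier : IsCompact R.carrier :=
  R.vertices.finite_toSet.isCompact_convexHull (𝕜 := ℝ)

theorem ext_of_eval_node {f g : MvPolynomial (Fin s) ℝ} (hf : f ∈ R.shape) (hg : g ∈ R.shape)
    (h : ∀ j, MvPolynomial.eval (fun i => R.node j i) f =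
      MvPolynomial.eval (fun i => R.node j i) g) : f = g :=
  (R.unisolvent _).unique ⟨hf, h⟩ ⟨hg, fun _ => rfl⟩

/-- The nodal basis of the reference element: `nodal j` is the shape function that is `1` at the
`j`-th node and vanishes at the others. -/
noncomputable def nodal (j : Fin R.numNodes) : MvPolynomial (Fin s) ℝ :=
  (R.unisolvent (Pi.single j 1)).choose

theorem nodal_mem (j : Fin R.numNodes) : R.nodal j ∈ R.shape :=
  (R.unisolvent (Pi.single j 1)).choose_spec.1.1

theorem eval_node_nodal (i j : Fin R.numNodes) :
    MvPolynomial.eval (fun a => R.node i a) (R.nodal j) = if i = j then 1 else 0 := by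
  rw [nodal, (R.unisolvent (Pi.single j 1)).choose_spec.1.2 i, Pi.single_apply]

theorem eq_sum_nodal {f : MvPolynomial (Fin s) ℝ} (hf : f ∈ R.shape) :
    f = ∑ j, MvPolynomial.eval (fun a => R.node j a) f • R.nodal j := by
  refine R.ext_of_eval_node hf
    (R.shape.sum_mem fun j _ => R.shape.smul_mem _ (R.nodal_mem j)) fun i => ?_
  simp [MvPolynomial.smul_eval, eval_node_nodal]

theorem one_mem_shape : (1 : MvPolynomial (Fin s) ℝ) ∈ R.shape :=
  R.degree_le_shape ((MvPolynomial.mem_restrictTotalDegree _ _ _).2 (by simp))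

theorem sum_nodal : ∑ j, R.nodal j = 1 := by
  simpa using (R.eq_sum_nodal R.one_mem_shape).symm

theorem numNodes_pos : 0 < R.numNodes := by
  rw [Nat.pos_iff_ne_zero]
  intro h
  have : IsEmpty (Fin R.numNodes) := h ▸ Fin.isEmpty
  have h1 := R.sum_nodal
  rw [Fintype.sum_empty] at h1
  exact zero_ne_one h1

/-- The nodal basis sums to `1`, so only differences of the nodal values enter the increments of
an interpolant. -/
theorem exists_norm_sum_nodal_sub_le : ∃ Λ : ℝ, 0 ≤ Λ ∧
    ∀ {n : ℕ} (c : Fin R.numNodes → Euc n) (b : ℝ),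
    (∀ i j, ‖c i - c j‖ ≤ b) → ∀ x ∈ R.carrier, ∀ y ∈ R.carrier,
      ‖∑ j, MvPolynomial.eval (fun a => y a) (R.nodal j) • c j -
        ∑ j, MvPolynomial.eval (fun a => x a) (R.nodal j) • c j‖ ≤ Λ * b * ‖y - x‖ := by
  choose K hK using fun j =>
    LipschitzOnWith.mvPolynomial_eval (R.nodal j) R.convex_carrier R.isCompact_carrier
  refine ⟨∑ j, K j, by positivity, fun {n} c b hb x hx y hy => ?_⟩
  let i : Fin R.numNodes := ⟨0, R.numNodes_pos⟩
  have hsum : ∀ z : Euc s, ∑ j, MvPolynomial.eval (fun a => z a) (R.nodal j) • c j =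
      ∑ j, MvPolynomial.eval (fun a => z a) (R.nodal j) • (c j - c i) + c i := by
    intro z
    have h1 : ∑ j, MvPolynomial.eval (fun a => z a) (R.nodal j) = 1 := by
      rw [← map_sum, R.sum_nodal, map_one]
    simp_rw [smul_sub]
    rw [Finset.sum_sub_distrib, ← Finset.sum_smul, h1, one_smul, sub_add_cancel]
  rw [hsum x, hsum y, add_sub_add_right_eq_sub, ← Finset.sum_sub_distrib, Finset.sum_mul,
    Finset.sum_mul]
  refine norm_sum_le_of_le _ fun j _ => ?_
  rw [← sub_smul, norm_smul]
  calc _ ≤ (K j * ‖y - x‖) * b :=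
        mul_le_mul ((hK j).norm_sub_le hy hx) (hb j i) (norm_nonneg _) (by positivity)
    _ = _ := by ring

end LagrangeElement

namespace LagrangeMesh

variable {s r : ℕ} {R : LagrangeElement s r} {Ω : Set (Euc s)} (G : LagrangeMesh R Ω)

theorem interpolate_point {n : ℕ} (v : Euc s → Euc n) (i : Fin G.numPoints) :
    G.interpolate v (G.point i) = v (G.point i) := by
  simp [interpolate, G.basis_point]

theorem interpolate_chart_node {n : ℕ} (v : Euc s → Euc n) (k : Fin G.numElements)
    (j : Fin R.numNodes) :
    G.interpolate v (G.chart k (R.node j)) = v (G.chart k (R.node j)) := by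
  have : G.chart k (R.node j) ∈ range G.point := by
    rw [G.range_point]
    exact mem_iUnion.2 ⟨k, mem_image_of_mem _ (mem_range_self j)⟩
  obtain ⟨i, hi⟩ := this
  rw [← hi, G.interpolate_point]

theorem interpolate_chart {n : ℕ} (v : Euc s → Euc n) (k : Fin G.numElements) {x : Euc s}
    (hx : x ∈ R.carrier) :
    G.interpolate v (G.chart k x) =
      ∑ j, MvPolynomial.eval (fun a => x a) (R.nodal j) • v (G.chart k (R.node j)) := by
  have hb : ∀ i, G.basis i (G.chart k x) =
      ∑ j, MvPolynomial.eval (fun a => x a) (R.nodal j) * G.basis i (G.chart k (R.node j)) := by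
    intro i
    obtain ⟨f, hf, hfx⟩ := G.basis_shape i k
    rw [hfx x hx]
    conv_lhs => rw [R.eq_sum_nodal hf]
    simp only [map_sum, MvPolynomial.smul_eval]
    exact Finset.sum_congr rfl fun j _ => by rw [hfx _ (R.node_mem j), mul_comm]
  simp_rw [← G.interpolate_chart_node v k]
  simp only [interpolate, hb, Finset.sum_smul, Finset.smul_sum, mul_smul]
  exact Finset.sum_comm

theorem convex_element (k : Fin G.numElements) : Convex ℝ (G.element k) :=
  R.convex_carrier.affine_image (G.chart k).toAffineMap

theorem isCompact_element (k : Fin G.numElements) : IsCompact (G.element k) :=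
  R.isCompact_carrier.image (G.chart k).continuous_of_finiteDimensional

theorem interior_element_nonempty (k : Fin G.numElements) : (interior (G.element k)).Nonempty := by
  have h : G.chart k '' interior R.carrier = interior (G.chart k '' R.carrier) :=
    (AffineEquiv.toContinuousAffineEquiv (G.chart k)).toHomeomorph.image_interior R.carrier
  rw [element, ← h]
  exact R.interior_nonempty.image _

theorem element_subset_closure (k : Fin G.numElements) : G.element k ⊆ closure Ω := by
  rw [← G.iUnion_eq]
  exact subset_iUnion (fun k => G.chart k '' R.carrier) k

theorem diam_element_le (k : Fin G.numElements) : Metric.diam (G.element k) ≤ Metric.diam Ω := by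
  rw [← Metric.diam_closure Ω]
  refine Metric.diam_mono (G.element_subset_closure k) ?_
  rw [← G.iUnion_eq]
  exact (isCompact_iUnion G.isCompact_element).isBounded

theorem diam_element_pos (hs : 1 ≤ s) (k : Fin G.numElements) :
    0 < Metric.diam (G.element k) := by
  have : Nonempty (Fin s) := ⟨⟨0, hs⟩⟩
  refine Metric.diam_nonneg.lt_of_ne fun h => ?_
  obtain ⟨x, hx⟩ := G.interior_element_nonempty k
  have hsub : G.element k ⊆ {x} := fun y hy => by
    have := Metric.dist_le_diam_of_mem (G.isCompact_element k).isBounded hy (interior_subset hx)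
    rw [← h] at this
    exact dist_le_zero.1 this
  have := interior_mono hsub hx
  rw [interior_singleton] at this
  exact this

theorem diam_element_le_width (k : Fin G.numElements) : Metric.diam (G.element k) ≤ G.width :=
  le_ciSup (f := fun k => Metric.diam (G.element k)) (finite_range _).bddAbove k

/-- The inverse chart maps an inscribed ball of radius `κ * h` into the reference element, which
bounds its linear part. -/
theorem norm_chart_symm_sub_le (hs : 1 ≤ s) {κ : ℝ} (hκ : 0 < κ) (hG : G.ShapeRegular κ)
    (k : Fin G.numElements) (x y : Euc s) :
    ‖(G.chart k).symm y - (G.chart k).symm x‖ ≤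
      Metric.diam R.carrier / (κ * Metric.diam (G.element k)) * ‖y - x‖ := by
  obtain ⟨z, hz⟩ := hG k
  have hρ : 0 < κ * Metric.diam (G.element k) := mul_pos hκ (G.diam_element_pos hs k)
  set ρ := κ * Metric.diam (G.element k)
  set A := (G.chart k).symm
  have hlin : ∀ a b, A a - A b = A.linear (a - b) := fun a b =>
    (A.toAffineMap.linearMap_vsub a b).symm
  have hmem : ∀ a ∈ Metric.ball z ρ, A a ∈ R.carrier := fun a ha => by
    obtain ⟨b, hb, rfl⟩ := hz ha
    simpa [A] using hb
  rcases eq_or_ne y x with rfl | hne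
  · simp
  have he : 0 < ‖y - x‖ := norm_pos_iff.2 (sub_ne_zero.2 hne)
  let e : Euc s := (ρ / 2 / ‖y - x‖) • (y - x)
  have hnorm : ‖e‖ = ρ / 2 := by
    rw [norm_smul, Real.norm_of_nonneg (by positivity), div_mul_cancel₀ _ he.ne']
  have h1 : z + e ∈ Metric.ball z ρ := by
    rw [Metric.mem_ball, dist_eq_norm, add_sub_cancel_left, hnorm]; linarith
  have h2 : z - e ∈ Metric.ball z ρ := by
    rw [Metric.mem_ball, dist_eq_norm, sub_sub_cancel_left, norm_neg, hnorm]; linarith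
  have h3 := Metric.dist_le_diam_of_mem R.isCompact_carrier.isBounded (hmem _ h1) (hmem _ h2)
  have h4 : z + e - (z - e) = (ρ / ‖y - x‖) • (y - x) := by
    rw [add_sub_sub_cancel, ← add_smul]
    congr 1
    ring
  rw [dist_eq_norm, hlin, h4, map_smul, norm_smul, Real.norm_of_nonneg (by positivity), ← hlin] at h3
  rw [div_mul_eq_mul_div, le_div_iff₀ hρ]
  rw [div_mul_eq_mul_div, div_le_iff₀ he] at h3
  linarith

theorem exists_norm_interpolate_sub_le (hs : 1 ≤ s) (R : LagrangeElement s r) {κ : ℝ} (hκ : 0 < κ) :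
    ∃ Λ : ℝ, 0 ≤ Λ ∧ ∀ {Ω : Set (Euc s)} (G : LagrangeMesh R Ω), G.ShapeRegular κ →
      ∀ {n : ℕ} (v : Euc s → Euc n) (k : Fin G.numElements) (b : ℝ), 0 ≤ b →
      (∀ i j, ‖v (G.chart k (R.node i)) - v (G.chart k (R.node j))‖ ≤ b) →
      ∀ x ∈ G.element k, ∀ y ∈ G.element k, ‖G.interpolate v y - G.interpolate v x‖ ≤
        Λ * b / Metric.diam (G.element k) * ‖y - x‖ := by
  obtain ⟨Λ, hΛ0, hΛ⟩ := R.exists_norm_sum_nodal_sub_le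
  refine ⟨Λ * (Metric.diam R.carrier / κ), by have := Metric.diam_nonneg (s := R.carrier); positivity,
    fun {Ω} G hG {n} v k b hb0 hb x hx y hy => ?_⟩
  have h1 := G.norm_chart_symm_sub_le hs hκ hG k x y
  obtain ⟨x', hx', rfl⟩ := hx
  obtain ⟨y', hy', rfl⟩ := hy
  rw [G.interpolate_chart v k hx', G.interpolate_chart v k hy']
  refine (hΛ _ b hb x' hx' y' hy').trans ?_
  rw [AffineEquiv.symm_apply_apply, AffineEquiv.symm_apply_apply] at h1
  calc Λ * b * ‖y' - x'‖ ≤ Λ * b * (Metric.diam R.carrier /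
        (κ * Metric.diam (G.element k)) * ‖G.chart k y' - G.chart k x'‖) := by gcongr
    _ = Λ * (Metric.diam R.carrier / κ) * b / Metric.diam (G.element k) *
        ‖G.chart k y' - G.chart k x'‖ := by
      have := (G.diam_element_pos hs k).ne'
      field_simp

theorem volume_interior_element_ne_top (k : Fin G.numElements) :
    volume (interior (G.element k)) ≠ ⊤ :=
  ((measure_mono interior_subset).trans_lt (G.isCompact_element k).measure_lt_top).ne

theorem volume_real_interior_element_pos (k : Fin G.numElements) :
    0 < volume.real (interior (G.element k)) :=
  ENNReal.toReal_pos (isOpen_interior.measure_pos volume (G.interior_element_nonempty k)).ne'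
    (G.volume_interior_element_ne_top k)

theorem volume_real_interior_element_le (hs : 1 ≤ s) (k : Fin G.numElements) :
    volume.real (interior (G.element k)) ≤
      Metric.diam (G.element k) ^ s * volume.real (Metric.ball (0 : Euc s) 1) := by
  have : Nonempty (Fin s) := ⟨⟨0, hs⟩⟩
  obtain ⟨x, hx⟩ := G.interior_element_nonempty k
  have hsub : interior (G.element k) ⊆ Metric.closedBall x (Metric.diam (G.element k)) :=
    fun y hy => Metric.dist_le_diam_of_mem (G.isCompact_element k).isBounded (interior_subset hy)
      (interior_subset hx)
  refine (measureReal_mono hsub (isCompact_closedBall _ _).measure_lt_top.ne).trans_eq ?_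
  rw [Measure.real, Measure.addHaar_closedBall volume x Metric.diam_nonneg, ENNReal.toReal_mul,
    ENNReal.toReal_ofReal (pow_nonneg Metric.diam_nonneg _), finrank_euclideanSpace_fin]
  rfl

theorem le_volume_real_interior_element (hs : 1 ≤ s) {κ : ℝ} (hκ : 0 < κ) (hG : G.ShapeRegular κ)
    (k : Fin G.numElements) :
    (κ * Metric.diam (G.element k)) ^ s * volume.real (Metric.ball (0 : Euc s) 1) ≤
      volume.real (interior (G.element k)) := by
  have : Nonempty (Fin s) := ⟨⟨0, hs⟩⟩
  obtain ⟨x, hx⟩ := hG k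
  have h0 : 0 ≤ κ * Metric.diam (G.element k) := mul_nonneg hκ.le Metric.diam_nonneg
  refine Eq.trans_le ?_ (measureReal_mono (interior_maximal hx Metric.isOpen_ball)
    (G.volume_interior_element_ne_top k))
  rw [Measure.real, Measure.real, Measure.addHaar_ball volume x h0, ENNReal.toReal_mul,
    ENNReal.toReal_ofReal (pow_nonneg h0 _), finrank_euclideanSpace_fin]

/-- For `α ≥ 0` this is the lower bound on the volume of an element that shape regularity and
quasi-uniformity give, for `α ≤ 0` the upper bound in terms of the diameter of the domain. -/
theorem exists_volume_rpow_le (hs : 1 ≤ s) (R : LagrangeElement s r) {κ τ : ℝ} (hκ : 0 < κ)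
    (hτ : 0 < τ) (D α : ℝ) :
    ∃ C : ℝ, 0 ≤ C ∧ ∀ {Ω : Set (Euc s)} (G : LagrangeMesh R Ω), Metric.diam Ω ≤ D →
      G.ShapeRegular κ → G.QuasiUniform τ → ∀ k : Fin G.numElements,
        volume.real (interior (G.element k)) ^ (-α) ≤ C * G.width ^ (-((s : ℝ) * max 0 α)) := by
  set c₁ := volume.real (Metric.ball (0 : Euc s) 1)
  have hc₁ : 0 < c₁ := ENNReal.toReal_pos
    (Metric.isOpen_ball.measure_pos volume ⟨0, by simp⟩).ne' measure_ball_lt_top.ne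
  refine ⟨(|D| ^ s * c₁) ^ (-α) + ((κ * τ) ^ s * c₁) ^ (-α), by positivity,
    fun {Ω} G hD hG hQ k => ?_⟩
  have hV := G.volume_real_interior_element_pos k
  have hk := G.diam_element_pos hs k
  have hw : 0 < G.width := hk.trans_le (G.diam_element_le_width k)
  rcases le_total α 0 with hα | hα
  · rw [max_eq_left hα, mul_zero, neg_zero, Real.rpow_zero, mul_one]
    refine le_add_of_le_of_nonneg ?_ (by positivity)
    refine Real.rpow_le_rpow hV.le ((G.volume_real_interior_element_le hs k).trans ?_)
      (by linarith)
    gcongr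
    exact (G.diam_element_le k).trans (hD.trans (le_abs_self D))
  · rw [max_eq_right hα, add_mul]
    refine le_add_of_nonneg_of_le (by positivity) ?_
    have h1 : G.width ^ s * ((κ * τ) ^ s * c₁) ≤ volume.real (interior (G.element k)) := by
      refine le_trans ?_ (G.le_volume_real_interior_element hs hκ hG k)
      calc G.width ^ s * ((κ * τ) ^ s * c₁) = (κ * (τ * G.width)) ^ s * c₁ := by ring
        _ ≤ _ := by
          gcongr
          exact hQ k
    refine (Real.rpow_le_rpow_of_nonpos (by positivity) h1 (by linarith)).trans_eq ?_
    rw [Real.mul_rpow (by positivity) (by positivity), ← Real.rpow_natCast, ← Real.rpow_mul hw.le,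
      mul_comm, mul_neg]

end LagrangeMesh

/-! ### The inverse estimate -/

theorem theorem2p5 {s n r : ℕ} (hs : 1 ≤ s) (R : LagrangeElement s r)
    (κ τ D : ℝ) (hκ : 0 < κ) (hτ : 0 < τ) (L : ℝ≥0)
    (p q : ℝ≥0∞) (hp : (s : ℝ≥0∞) < p) (hq : 1 ≤ q) :
    ∃ C : ℝ, 0 < C ∧
      ∀ (Ω : Set (Euc s)), IsOpen Ω → Metric.diam Ω ≤ D →
      ∀ (G : LagrangeMesh R Ω), G.ShapeRegular κ → G.QuasiUniform τ →
      ∀ (M : Set (Euc n)) (δ : ℝ), 0 < δ →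
        (∀ z ∈ Metric.thickening δ M, ∃! y, IsClosestPoint M z y) →
        sobolevSeminorm ⊤ (Metric.thickening δ M) (closestPoint M) ≤ (L : ℝ≥0∞) →
      ∀ (v : Euc s → Euc n), ContinuousOn v (closure Ω) → MapsTo v (closure Ω) M →
        MapsTo (G.interpolate v) (closure Ω) (Metric.thickening δ M) →
      ∀ k : Fin G.numElements,
        sobolevSeminorm p (interior (G.element k)) (G.projInterpolate M v) < ⊤ ∧
        sobolevSeminorm q (interior (G.element k)) (G.projInterpolate M v) ≤
          ENNReal.ofReal (C * G.width ^ (-((s : ℝ) * max 0 ((p⁻¹).toReal - (q⁻¹).toReal)))) *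
            sobolevSeminorm p (interior (G.element k)) (G.projInterpolate M v) := by
  have hp1 : 1 ≤ p := le_trans (by exact_mod_cast hs) hp.le
  obtain ⟨Λ, hΛ0, hΛ⟩ := LagrangeMesh.exists_norm_interpolate_sub_le hs R hκ
  obtain ⟨C₀, hC₀, hvol⟩ := LagrangeMesh.exists_volume_rpow_le hs R hκ hτ D
    ((p⁻¹).toReal - (q⁻¹).toReal)
  set β := (p⁻¹).toReal with hβ
  set γ := (q⁻¹).toReal with hγ
  -- Since `s * β < 1`, the absolute value changes nothing; it makes the sign evident.
  set C₁ := |2 / (1 - s * β)|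
  refine ⟨(L + 1) * (Λ * C₁) * C₀ + 1, by positivity, ?_⟩
  intro Ω _ hD G hG hQ M δ hδ hM hL v _ hvM hu k
  set T := G.element k
  set u := G.interpolate v
  set w := G.projInterpolate M v
  have hTΩ : T ⊆ closure Ω := G.element_subset_closure k
  have hTc : IsCompact T := G.isCompact_element k
  have hd : 0 < Metric.diam T := G.diam_element_pos hs k
  have hV : 0 < volume.real (interior T) := G.volume_real_interior_element_pos k
  have hnode : ∀ j, G.chart k (R.node j) ∈ T := fun j => mem_image_of_mem _ (R.node_mem j)
  have hcomp : ∀ b : ℝ, 0 ≤ b →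
      (∀ i j, ‖v (G.chart k (R.node i)) - v (G.chart k (R.node j))‖ ≤ b) →
      (∃ K', LipschitzOnWith K' w T) ∧ ∃ ε > 0, ∀ x ∈ T, ∀ y ∈ T, ‖y - x‖ < ε →
        ‖w y - w x‖ ≤ (L + 1) * (Λ * b / Metric.diam T) * ‖y - x‖ := by
    intro b hb0 hb
    have hK0 : 0 ≤ Λ * b / Metric.diam T := by positivity
    refine closestPoint_comp_lipschitz hδ hM hL hTc (u := u) (K := ⟨Λ * b / Metric.diam T, hK0⟩)
      (LipschitzOnWith.of_dist_le_mul fun y hy x hx => ?_) (hu.mono_left hTΩ)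
    rw [dist_eq_norm, dist_eq_norm]
    exact hΛ G hG v k b hb0 hb x hx y hy
  -- Any bound on the nodal values makes `w` Lipschitz, so that Morrey's inequality applies to it.
  obtain ⟨K', hw⟩ := (hcomp
    (∑ i, ∑ j, ‖v (G.chart k (R.node i)) - v (G.chart k (R.node j))‖) (by positivity) fun i j =>
      (Finset.single_le_sum (f := fun j => ‖v (G.chart k (R.node i)) - v (G.chart k (R.node j))‖)
        (fun _ _ => norm_nonneg _) (Finset.mem_univ j)).trans
      (Finset.single_le_sum (f := fun i => ∑ j, ‖v (G.chart k (R.node i)) -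
        v (G.chart k (R.node j))‖) (fun _ _ => by positivity) (Finset.mem_univ i))).1
  have hweak := (hw.mono interior_subset).hasWeakFDeriv isOpen_interior
  rw [sobolevSeminorm_eq_eLpNorm isOpen_interior hweak, sobolevSeminorm_eq_eLpNorm isOpen_interior hweak]
  have hvoltop : volume (interior T) ≠ ⊤ := G.volume_interior_element_ne_top k
  have : IsFiniteMeasure (volume.restrict (interior T)) := isFiniteMeasure_restrict.2 hvoltop
  have hfin : eLpNorm (fderiv ℝ w) p (volume.restrict (interior T)) < ⊤ :=
    (MemLp.of_bound (measurable_fderiv ℝ w).aestronglyMeasurable K'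
      ((ae_restrict_iff' isOpen_interior.measurableSet).2 (.of_forall fun x hx =>
        norm_fderiv_le_of_lipschitzOn ℝ (mem_interior_iff_mem_nhds.1 hx) hw))).eLpNorm_lt_top
  refine ⟨hfin, ?_⟩
  set N := (eLpNorm (fderiv ℝ w) p (volume.restrict (interior T))).toReal with hN
  have hN0 : 0 ≤ N := ENNReal.toReal_nonneg
  have hwv : ∀ j, w (G.chart k (R.node j)) = v (G.chart k (R.node j)) := fun j => by
    have : w (G.chart k (R.node j)) = closestPoint M (G.interpolate v (G.chart k (R.node j))) := rfl
    rw [this, G.interpolate_chart_node, closestPoint_of_mem (hvM (hTΩ (hnode j)))]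
  -- The interpolant is determined by the nodal values of `w`, whose differences Morrey bounds.
  set b := C₁ * Metric.diam T * volume.real (interior T) ^ (-β) * N with hb
  have hb0 : 0 ≤ b := by positivity
  have hbv : ∀ i j, ‖v (G.chart k (R.node i)) - v (G.chart k (R.node j))‖ ≤ b := by
    intro i j
    rw [← hwv i, ← hwv j]
    refine (norm_sub_le_eLpNorm_fderiv (G.convex_element k) hTc (G.interior_element_nonempty k) hw
      hp1 hp (hnode i) (hnode j)).trans ?_
    rw [hb]
    gcongr
    exact le_abs_self _
  obtain ⟨-, ε, hε, hloc⟩ := hcomp b hb0 hbv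
  set B := (L + 1) * (Λ * b / Metric.diam T) with hB
  have hB0 : 0 ≤ B := by positivity
  have hder : ∀ x ∈ interior T, ‖fderiv ℝ w x‖ ≤ B := fun x hx => by
    refine norm_fderiv_le_of_lip' ℝ hB0 ?_
    filter_upwards [mem_interior_iff_mem_nhds.1 hx, Metric.ball_mem_nhds x hε] with y hy hyε
    exact hloc x (interior_subset hx) y hy (by rwa [← dist_eq_norm])
  refine (eLpNorm_le_of_ae_bound ((ae_restrict_iff' isOpen_interior.measurableSet).2
    (.of_forall hder))).trans ?_
  rw [Measure.restrict_apply_univ, ← ENNReal.toReal_inv, ← hγ,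
    ← ENNReal.ofReal_toReal hfin.ne, ← hN, ← ofReal_measureReal hvoltop,
    ENNReal.ofReal_rpow_of_pos hV, ← ENNReal.ofReal_mul (by positivity),
    ← ENNReal.ofReal_mul' hN0]
  refine ENNReal.ofReal_le_ofReal ?_
  have hw0 : 0 ≤ G.width := hd.le.trans (G.diam_element_le_width k)
  have hVγ : volume.real (interior T) ^ γ * volume.real (interior T) ^ (-β) ≤
      C₀ * G.width ^ (-((s : ℝ) * max 0 (β - γ))) := by
    rw [← Real.rpow_add hV, show γ + -β = -(β - γ) by ring]
    exact hvol G hD hG hQ k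
  calc volume.real (interior T) ^ γ * B
      = (L + 1) * (Λ * C₁) *
          (volume.real (interior T) ^ γ * volume.real (interior T) ^ (-β)) * N := by
        rw [hB, hb]
        field_simp
    _ ≤ (L + 1) * (Λ * C₁) * (C₀ * G.width ^ (-((s : ℝ) * max 0 (β - γ)))) * N := by gcongr
    _ ≤ ((L + 1) * (Λ * C₁) * C₀ + 1) * G.width ^ (-((s : ℝ) * max 0 (β - γ))) * N := by
        rw [← mul_assoc]
        gcongr
        exact le_add_of_nonneg_right zero_le_one
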